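/- Let $I$ be a finite set of students and $S$ a finite set of schools. Each school $s$ has a quota $q_s\in\{0,1,2,\dots\}$ and a linear order $\succsim_s$ over $I$ (its priority, with strict part $\succ_s$). A tier structure is a map $t:S\to\{1,\dots,T\}$, $T\ge 1$, whose tiers $S_k=\{s: t_s=k\}$ are all nonempty. A preference of student $i$ is a linear order $R_i$ over $S\cup\{i\}$, where $i$ stands for being unmatched; $P_i$ is its strict part. A matching is a map $\mu:I\to S\cup I$ with $\mu(i)\in S\cup\{i\}$ for all $i$ and $|\mu^{-1}(s)|\le q_s$ for all $s$. It is stable with respect to $(q,\succsim,R)$ if (1) $\mu(i)\,R_i\,i$ for every $i$; (2) there are no $i,j\in I$ and $s\in S$ with $\mu(j)=s$, $s\,P_i\,\mu(i)$ and $i\succ_s j$; and (3) there are no $i\in I$ and $s\in S$ with $s\,P_i\,\mu(i)$ and $|\mu^{-1}(s)|<q_s$. The tiered deferred acceptance mechanism $TDA(t)$ works in $T$ rounds: in round $k$, the student-proposing deferred acceptance algorithm is run for the students who are still unmatched and the schools in $S_k$, with the quotas and priorities of these schools and the students' reported preferences truncated to $S_k$ and being unmatched; students matched in a round keep that school, and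 students unmatched after round $T$ remain unmatched. Given true preferences $R$, a profile $Q$ of reported preferences is a Nash equilibrium if, for every student $i$ and every preference $Q_i'$, $TDA(t)(Q)(i)\;R_i\;TDA(t)(Q_i',Q_{-i})(i)$; its outcome is the matching $TDA(t)(Q)$. A cycle consists of distinct schools $a,b$ and distinct students $i,j,k$ such that $i\succ_a j\succ_a k$ and $k\succ_b i$, and there are disjoint (possibly empty) sets $I_a,I_b\subseteq I\setminus\{i,j,k\}$ with $|I_a|=q_a-1$, $|I_b|=q_b-1$, $l\succ_a j$ for all $l\in I_a$, and $l\succ_b i$ for all $l\in I_b$. The generalized priority structure $(q,\succsim,t)$ is within-tier acyclic if there is no cycle whose two schools belong to the same tier. Theorem 2. A generalized priority structure $(q,\succsim,t)$ is within-tier acyclic if and only if, for every preference profile $R=(R_i)_{i\in I}$, the set of stable matchings with respect to $(q,\succsim,R)$ equals the set of Nash equilibrium outcomes of $TDA(t)$ when the true preferences are $R$. -/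

import Mathlib

namespace SchoolChoice

/-- A linear order (reflexive, antisymmetric, transitive, complete) on `α`, read as a ranking:
`r.weak x y` says that `x` is ranked at least as high as `y`. -/
structure Ranking (α : Type*) where
  weak : α → α → Prop
  refl : ∀ x, weak x x
  antisymm : ∀ x y, weak x y → weak y x → x = y
  trans : ∀ x y z, weak x y → weak y z → weak x z
  total : ∀ x y, weak x y ∨ weak y x

/-- The strict part of a ranking. -/
def Ranking.strict {α : Type*} (r : Ranking α) (x y : α) : Prop :=
  r.weak x y ∧ x ≠ y

theorem Ranking.exists_best {α : Type*} (r : Ranking α) (A : Finset α) (hA : A.Nonempty) :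
    ∃ x ∈ A, ∀ y ∈ A, r.weak x y := by
  classical
  induction hA using Finset.Nonempty.cons_induction with
  | singleton a => exact ⟨a, by simp, by simpa using r.refl a⟩
  | cons a s ha hs ih =>
    obtain ⟨x, hx, hmax⟩ := ih
    rcases r.total a x with h | h
    · refine ⟨a, by simp, fun y hy => ?_⟩
      rcases Finset.mem_cons.1 hy with rfl | hy
      · exact r.refl _
      · exact r.trans _ _ _ h (hmax y hy)
    · refine ⟨x, by simp [hx], fun y hy => ?_⟩
      rcases Finset.mem_cons.1 hy with rfl | hy
      · exact h
      · exact hmax y hy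

/-- The highest ranked element of a nonempty finite set. -/
noncomputable def Ranking.best {α : Type*} (r : Ranking α) (A : Finset α) (hA : A.Nonempty) : α :=
  (r.exists_best A hA).choose

/-- The preference of a student: a linear order over the schools and the student himself.
Being unmatched (the student himself) is `none`; school `s` is `some s`. -/
abbrev Preference (S : Type*) := Ranking (Option S)

/-- A priority structure: quotas (possibly zero) and, for each school, a linear order over the
students. -/
structure PriorityStructure (I S : Type*) where
  quota : S → ℕ
  priority : S → Ranking I

/-- A tier structure: the schools are partitioned into nonempty tiers `1, …, numTiers`. -/
structure TierStructure (S : Type*) where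
  numTiers : ℕ
  numTiers_pos : 0 < numTiers
  tier : S → ℕ
  tier_mem : ∀ s, tier s ∈ Finset.Icc 1 numTiers
  tier_nonempty : ∀ k ∈ Finset.Icc 1 numTiers, ∃ s, tier s = k

section Matchings

variable {I S : Type*} [Fintype I]

open Classical in
/-- The students assigned to school `s` under `μ`. -/
noncomputable def assigned (μ : I → Option S) (s : S) : Finset I :=
  Finset.univ.filter fun i => μ i = some s

/-- `μ` is a matching: no quota is exceeded. -/
def IsMatching (E : PriorityStructure I S) (μ : I → Option S) : Prop :=
  ∀ s, (assigned μ s).card ≤ E.quota s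

def IndividuallyRational (R : I → Preference S) (μ : I → Option S) : Prop :=
  ∀ i, (R i).weak (μ i) none

def NoJustifiedEnvy (E : PriorityStructure I S) (R : I → Preference S) (μ : I → Option S) : Prop :=
  ¬ ∃ (i j : I) (s : S),
    μ j = some s ∧ (R i).strict (some s) (μ i) ∧ (E.priority s).strict i j

def NonWasteful (E : PriorityStructure I S) (R : I → Preference S) (μ : I → Option S) : Prop :=
  ¬ ∃ (i : I) (s : S), (R i).strict (some s) (μ i) ∧ (assigned μ s).card < E.quota s

/-- The set of stable matchings of the problem `(E, R)`. -/
def stableMatchings (E : PriorityStructure I S) (R : I → Preference S) : Set (I → Option S) :=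
  {μ | IsMatching E μ ∧ IndividuallyRational R μ ∧ NoJustifiedEnvy E R μ ∧ NonWasteful E R μ}

end Matchings

section DeferredAcceptance

variable {I S : Type*}

open Classical in
/-- The alternatives in `B ∪ {i}` that have not yet rejected a student, where `rej` is the set of
schools that have. -/
noncomputable def available (B rej : Finset S) : Finset (Option S) :=
  insert none ((B \ rej).image some)

theorem available_nonempty (B rej : Finset S) : (available B rej).Nonempty :=
  ⟨none, by simp [available]⟩

/-- The best alternative in `B ∪ {i}`, according to the preference `r`, that has not yet rejected
the student. In the course of the algorithm this is the alternative that tentatively holds him,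
if there is one, and the one he proposes to next, otherwise. Only the restriction of `r` to
`B ∪ {i}` (the truncated preference) matters. -/
noncomputable def target (r : Preference S) (B rej : Finset S) : Option S :=
  r.best (available B rej) (available_nonempty B rej)

open Classical in
/-- The pool of school `s`: the students in `A` that propose to `s` in the current step or are
tentatively held by `s` from the previous one. -/
noncomputable def pool (R : I → Preference S) (A : Finset I) (B : Finset S) (rej : I → Finset S)
    (s : S) : Finset I :=
  A.filter fun i => target (R i) B (rej i) = some s

open Classical in
/-- One step of deferred acceptance: each school `s` in `B` keeps the `q s` highest ranked students
in its pool (those with fewer than `q s` better students in the pool) and rejects the others. -/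
noncomputable def daStep (E : PriorityStructure I S) (R : I → Preference S)
    (A : Finset I) (B : Finset S) (rej : I → Finset S) : I → Finset S :=
  fun i => rej i ∪ B.filter fun s =>
    i ∈ pool R A B rej s ∧
      E.quota s ≤ ((pool R A B rej s).filter fun j => (E.priority s).strict j i).card

/-- The rejections made in the first `n` steps of the algorithm. -/
noncomputable def daRejections (E : PriorityStructure I S) (R : I → Preference S)
    (A : Finset I) (B : Finset S) (n : ℕ) : I → Finset S :=
  (daStep E R A B)^[n] fun _ => ∅

open Classical in
/-- The outcome of the deferred acceptance algorithm for the students in `A` and the schools in `B`.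
The algorithm stops when a step brings no new rejection, hence no new proposal. This has happened
after `|A| * |B|` steps (see `daStep_final`), and later steps change nothing.
Students outside `A` do not take part and are given the value `none`. -/
noncomputable def deferredAcceptance (E : PriorityStructure I S) (R : I → Preference S)
    (A : Finset I) (B : Finset S) : I → Option S :=
  fun i => if i ∈ A then target (R i) B (daRejections E R A B (A.card * B.card) i) else none

theorem subset_daStep (E : PriorityStructure I S) (R : I → Preference S)
    (A : Finset I) (B : Finset S) (rej : I → Finset S) (i : I) :
    rej i ⊆ daStep E R A B rej i := by
  classical
  unfold daStep
  exact Finset.subset_union_left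

theorem daRejections_subset (E : PriorityStructure I S) (R : I → Preference S)
    (A : Finset I) (B : Finset S) (n : ℕ) (i : I) : daRejections E R A B n i ⊆ B := by
  classical
  induction n with
  | zero => simp [daRejections]
  | succ n ih =>
    unfold daRejections at ih ⊢
    rw [Function.iterate_succ_apply']
    unfold daStep at ih ⊢
    exact Finset.union_subset ih (Finset.filter_subset _ _)

/-- The algorithm has terminated after `|A| * |B|` steps: a further step changes nothing. -/
theorem daStep_final (E : PriorityStructure I S) (R : I → Preference S)
    (A : Finset I) (B : Finset S) :
    daStep E R A B (daRejections E R A B (A.card * B.card)) =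
      daRejections E R A B (A.card * B.card) := by
  classical
  have hsucc : ∀ n, daRejections E R A B (n + 1) = daStep E R A B (daRejections E R A B n) :=
    fun n => Function.iterate_succ_apply' _ _ _
  have houtside : ∀ rej : I → Finset S, ∀ i, i ∉ A → daStep E R A B rej i = rej i := by
    intro rej i hi
    simp [daStep, pool, hi]
  have hfix : ∀ n, daStep E R A B (daRejections E R A B n) = daRejections E R A B n →
      daStep E R A B (daRejections E R A B (n + 1)) = daRejections E R A B (n + 1) := by
    intro n h
    rw [hsucc, h, h]
  have key : ∀ n, daStep E R A B (daRejections E R A B n) = daRejections E R A B n ∨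
      n + 1 ≤ ∑ i ∈ A, (daRejections E R A B (n + 1) i).card := by
    intro n
    induction n with
    | zero =>
      by_cases h : daStep E R A B (daRejections E R A B 0) = daRejections E R A B 0
      · exact Or.inl h
      · right
        by_contra hlt
        apply h
        have h0 : ∑ i ∈ A, (daRejections E R A B (0 + 1) i).card = 0 := by omega
        rw [hsucc] at h0
        funext i
        by_cases hi : i ∈ A
        · have h1 := Finset.card_eq_zero.1 (Finset.sum_eq_zero_iff.1 h0 i hi)
          have h2 := subset_daStep E R A B (daRejections E R A B 0) i
          rw [h1] at h2 ⊢
          exact (Finset.subset_empty.1 h2).symm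
        · exact houtside _ i hi
    | succ n ih =>
      rcases ih with h | h
      · exact Or.inl (hfix n h)
      · by_cases hf : daStep E R A B (daRejections E R A B (n + 1)) = daRejections E R A B (n + 1)
        · exact Or.inl hf
        · right
          have hlt : ∑ i ∈ A, (daRejections E R A B (n + 1) i).card <
              ∑ i ∈ A, (daRejections E R A B (n + 1 + 1) i).card := by
            rw [hsucc (n + 1)]
            obtain ⟨i, hi⟩ := Function.ne_iff.1 hf
            have hiA : i ∈ A := by
              by_contra hiA
              exact hi (houtside _ i hiA)
            refine Finset.sum_lt_sum
              (fun j _ => Finset.card_le_card (subset_daStep E R A B _ j)) ⟨i, hiA, ?_⟩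
            exact Finset.card_lt_card
              (lt_of_le_of_ne (subset_daStep E R A B _ i) (Ne.symm hi))
          omega
  rcases key (A.card * B.card) with h | h
  · exact h
  · exfalso
    have hle : ∑ i ∈ A, (daRejections E R A B (A.card * B.card + 1) i).card ≤ A.card * B.card := by
      calc _ ≤ ∑ _i ∈ A, B.card :=
            Finset.sum_le_sum fun i _ => Finset.card_le_card (daRejections_subset E R A B _ i)
        _ = A.card * B.card := by simp
    omega

end DeferredAcceptance

section Tiers

variable {I S : Type*} [Fintype I] [Fintype S]

open Classical in
/-- The set of schools in tier `k`. -/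
noncomputable def tierSchools (t : TierStructure S) (k : ℕ) : Finset S :=
  Finset.univ.filter fun s => t.tier s = k

open Classical in
/-- The assignments made in the first `k` rounds of the tiered deferred acceptance mechanism:
in round `k + 1`, deferred acceptance is run for the students that are still unmatched and the
schools in tier `k + 1`; students matched in earlier rounds keep their schools. -/
noncomputable def tdaAfter (E : PriorityStructure I S) (t : TierStructure S)
    (Q : I → Preference S) : ℕ → I → Option S
  | 0 => fun _ => none
  | k + 1 => fun i =>
      if tdaAfter E t Q k i = none then
        deferredAcceptance E Q (Finset.univ.filter fun j => tdaAfter E t Q k j = none)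
          (tierSchools t (k + 1)) i
      else tdaAfter E t Q k i

/-- The outcome of the tiered deferred acceptance mechanism for reported preferences `Q`. -/
noncomputable def TDA (E : PriorityStructure I S) (t : TierStructure S)
    (Q : I → Preference S) : I → Option S :=
  tdaAfter E t Q t.numTiers

open Classical in
/-- `Q` is a pure Nash equilibrium of the preference revelation game induced by the tiered deferred
acceptance mechanism when the true preferences are `R`. -/
def IsNashEquilibrium (E : PriorityStructure I S) (t : TierStructure S)
    (R Q : I → Preference S) : Prop :=
  ∀ (i : I) (Q' : Preference S),
    (R i).weak (TDA E t Q i) (TDA E t (Function.update Q i Q') i)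

/-- The set of Nash equilibrium outcomes of the tiered deferred acceptance mechanism. -/
def nashOutcomes (E : PriorityStructure I S) (t : TierStructure S)
    (R : I → Preference S) : Set (I → Option S) :=
  {μ | ∃ Q, IsNashEquilibrium E t R Q ∧ TDA E t Q = μ}

end Tiers

section Acyclicity

variable {I S : Type*}

/-- The schools `a`, `b` and the students `i`, `j`, `k` form a cycle. The conditions
`|I_a| = q_a - 1`, `|I_b| = q_b - 1` are between integers: they fail if the quota is zero. -/
def IsCycle (E : PriorityStructure I S) (a b : S) (i j k : I) : Prop :=
  a ≠ b ∧ i ≠ j ∧ j ≠ k ∧ i ≠ k ∧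
  (E.priority a).strict i j ∧ (E.priority a).strict j k ∧ (E.priority b).strict k i ∧
  ∃ Ia Ib : Finset I, Disjoint Ia Ib ∧
    (∀ l ∈ Ia, l ≠ i ∧ l ≠ j ∧ l ≠ k) ∧ (∀ l ∈ Ib, l ≠ i ∧ l ≠ j ∧ l ≠ k) ∧
    (∀ l ∈ Ia, (E.priority a).strict l j) ∧ (∀ l ∈ Ib, (E.priority b).strict l i) ∧
    (Ia.card : ℤ) = (E.quota a : ℤ) - 1 ∧ (Ib.card : ℤ) = (E.quota b : ℤ) - 1

/-- A priority structure is acyclic if it has no cycles. -/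
def Acyclic (E : PriorityStructure I S) : Prop :=
  ¬ ∃ (a b : S) (i j k : I), IsCycle E a b i j k

/-- The restriction of a priority structure to the schools with property `p`. -/
def PriorityStructure.restrict (E : PriorityStructure I S) (p : S → Prop) :
    PriorityStructure I {s : S // p s} where
  quota s := E.quota s.1
  priority s := E.priority s.1

/-- In every tier, the priority structure restricted to the schools of the tier is acyclic. -/
def WithinTierAcyclic (E : PriorityStructure I S) (t : TierStructure S) : Prop :=
  ∀ k ∈ Finset.Icc 1 t.numTiers, Acyclic (E.restrict fun s => t.tier s = k)

end Acyclicity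

end SchoolChoice

/-!
The proof rests on three facts about deferred acceptance (DA) in a single market: its outcome is
stable within the market (`excludes_of_strict`), a school that has rejected a student remains full
of students with a higher priority (`quota_le_of_mem_daRejections`), and each rejection in a market
also happens in every larger one (`daRejections_subset_finalRejections`).

*Stable matchings are equilibrium outcomes*, without any assumption on the priorities: all students
report their school in the matching as the only acceptable one. A deviation that brings a student to
a better school `s` would displace a student with a lower priority or fill a vacant seat, against
stability.

*Equilibrium outcomes are stable under acyclicity.* If `i` has justified envy at `s` in an
equilibrium, or a preferred school `s` has a vacant seat, then `i` may report `s` as the only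
acceptable school. This leaves weakly fewer competitors in each round before that of `s`
(`unmatchedAfter_mono`). Let `μ` be the outcome of DA in the round of `s` without `i`, and `ν` the
outcome with `i`. In `μ`, the school `s` would still admit `i`; suppose that it rejects `i` in `ν`.
All students weakly prefer `μ` to `ν`, so a count shows that the students move from `ν` to `μ` along
closed walks of schools (`exchange`). One such walk runs through `s`, where some student of `μ` has
a lower priority than `i`, who in turn has a lower priority than all students of `ν`. Following a
shortest walk, one finds a cycle with two schools (`exists_isCycle_of_blockWalk`).

*A cycle within a tier gives an unstable equilibrium outcome* for suitable preferences: the student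
`j` of the cycle gives up on `a`, since an application would only start a rejection chain that
returns to `a` and expels `j` again (`TDA_cyclePreference_ne`); so `k` is admitted to `a`, and `j`
has justified envy.
-/

namespace SchoolChoice

open Relation

/-! ### Rankings -/

namespace Ranking

variable {α : Type*} (r : Ranking α)

theorem strict_irrefl (x : α) : ¬ r.strict x x := fun h => h.2 rfl

theorem strict_trans {x y z : α} (h : r.strict x y) (h' : r.strict y z) : r.strict x z := by
  refine ⟨r.trans _ _ _ h.1 h'.1, ?_⟩
  rintro rfl
  exact h.2 (r.antisymm _ _ h.1 h'.1)

theorem strict_asymm {x y : α} (h : r.strict x y) : ¬ r.strict y x :=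
  fun h' => r.strict_irrefl x (r.strict_trans h h')

theorem strict_of_not_strict {x y : α} (h : ¬ r.strict x y) (hne : x ≠ y) : r.strict y x := by
  rcases r.total x y with h' | h'
  · exact absurd ⟨h', hne⟩ h
  · exact ⟨h', hne.symm⟩

theorem weak_of_not_strict {x y : α} (h : ¬ r.strict x y) : r.weak y x := by
  by_cases hne : x = y
  · exact hne ▸ r.refl x
  · exact (r.strict_of_not_strict h hne).1

theorem not_strict_of_weak {x y : α} (h : r.weak x y) : ¬ r.strict y x :=
  fun h' => h'.2 (r.antisymm _ _ h'.1 h)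

theorem exists_worst (A : Finset α) (hA : A.Nonempty) : ∃ x ∈ A, ∀ y ∈ A, r.weak y x :=
  exists_best ⟨fun x y => r.weak y x, r.refl, fun _ _ h h' => r.antisymm _ _ h' h,
    fun _ _ _ h h' => r.trans _ _ _ h' h, fun x y => r.total y x⟩ A hA

theorem best_mem (A : Finset α) (hA : A.Nonempty) : r.best A hA ∈ A :=
  (r.exists_best A hA).choose_spec.1

theorem best_weak (A : Finset α) (hA : A.Nonempty) {y : α} (hy : y ∈ A) :
    r.weak (r.best A hA) y :=
  (r.exists_best A hA).choose_spec.2 y hy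

open Classical in
/-- If at least `q` elements of `P` are ranked above `x`, then at least `q` of them are also among
the `q` best elements of `P`. -/
theorem le_card_filter_top (P : Finset α) (q : ℕ) (x : α)
    (h : q ≤ (P.filter fun y => r.strict y x).card) :
    q ≤ ((P.filter fun y => (P.filter fun z => r.strict z y).card < q).filter
      fun y => r.strict y x).card := by
  by_contra! hlt
  obtain ⟨y₀, hy₀, hy₀'⟩ := Finset.exists_mem_notMem_of_card_lt_card (lt_of_lt_of_le hlt h)
  -- The best element above `x` that is not among the `q` best of `P` has fewer than `q` betters.
  obtain ⟨y, hy, hbest⟩ := r.exists_best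
    ((P.filter fun y => r.strict y x) \
      ((P.filter fun y => (P.filter fun z => r.strict z y).card < q).filter
        fun y => r.strict y x)) ⟨y₀, Finset.mem_sdiff.2 ⟨hy₀, hy₀'⟩⟩
  simp only [Finset.mem_sdiff, Finset.mem_filter, not_and] at hy hbest
  obtain ⟨⟨hyP, hyx⟩, hy'⟩ := hy
  refine hy' ⟨hyP, lt_of_le_of_lt (Finset.card_le_card fun z hz => ?_) hlt⟩ hyx
  simp only [Finset.mem_filter] at hz ⊢
  have hzx := r.strict_trans hz.2 hyx
  by_contra hcon
  refine r.not_strict_of_weak (hbest z ⟨⟨hz.1, hzx⟩, fun h1 _ => hcon ⟨h1, hzx⟩⟩) hz.2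

end Ranking

/-! ### Deferred acceptance in a single market -/

section Target

variable {S : Type*} {r : Preference S} {B rej rej' : Finset S}

theorem mem_available_some {s : S} : some s ∈ available B rej ↔ s ∈ B ∧ s ∉ rej := by
  simp [available]

theorem target_weak_none : r.weak (target r B rej) none :=
  r.best_weak _ _ (by simp [available])

theorem target_weak {s : S} (hs : s ∈ B) (hr : s ∉ rej) : r.weak (target r B rej) (some s) :=
  r.best_weak _ _ (mem_available_some.2 ⟨hs, hr⟩)

theorem mem_of_target {s : S} (h : target r B rej = some s) : s ∈ B ∧ s ∉ rej :=
  mem_available_some.1 (h ▸ r.best_mem _ (available_nonempty B rej))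

theorem acceptable_of_target {s : S} (h : target r B rej = some s) : r.strict (some s) none :=
  ⟨h ▸ target_weak_none, by simp⟩

/-- Rejections by other schools do not change the alternative to which a student proposes. -/
theorem target_eq_of_subset (hsub : rej ⊆ rej') {s : S} (h : target r B rej = some s)
    (hs : s ∉ rej') : target r B rej' = some s := by
  refine r.antisymm _ _ (target_weak (mem_of_target h).1 hs) ?_
  rcases h' : target r B rej' with _ | c
  · exact (acceptable_of_target h).1
  · have := mem_of_target h'
    exact h ▸ target_weak this.1 fun hc => this.2 (hsub hc)

end Target

section Market

variable {I S : Type*} {E : PriorityStructure I S} {Q Q' : I → Preference S}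
  {A A' : Finset I} {B : Finset S}

/-- The rejections made in the whole course of the deferred acceptance algorithm. -/
noncomputable def finalRejections (E : PriorityStructure I S) (Q : I → Preference S)
    (A : Finset I) (B : Finset S) : I → Finset S :=
  daRejections E Q A B (A.card * B.card)

theorem mem_pool {rej : I → Finset S} {s : S} {i : I} :
    i ∈ pool Q A B rej s ↔ i ∈ A ∧ target (Q i) B (rej i) = some s := by
  simp [pool]

theorem daRejections_succ (n : ℕ) :
    daRejections E Q A B (n + 1) = daStep E Q A B (daRejections E Q A B n) :=
  Function.iterate_succ_apply' _ _ _

open Classical in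
theorem mem_daStep {rej : I → Finset S} {s : S} {i : I} :
    s ∈ daStep E Q A B rej i ↔ s ∈ rej i ∨ (i ∈ pool Q A B rej s ∧
      E.quota s ≤ ((pool Q A B rej s).filter fun j => (E.priority s).strict j i).card) := by
  simp only [daStep, Finset.mem_union, Finset.mem_filter]
  constructor
  · rintro (h | h)
    · exact Or.inl h
    · exact Or.inr h.2
  · rintro (h | h)
    · exact Or.inl h
    · exact Or.inr ⟨(mem_of_target (mem_pool.1 h.1).2).1, h⟩

open Classical in
/-- A school that has rejected a student holds, from then on, as many students with a higher
priority as its quota allows. -/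
theorem quota_le_of_mem_daRejections (n : ℕ) {i : I} {s : S}
    (h : s ∈ daRejections E Q A B n i) :
    E.quota s ≤ ((pool Q A B (daRejections E Q A B n) s).filter
      fun j => (E.priority s).strict j i).card := by
  induction n generalizing i with
  | zero => simp [daRejections] at h
  | succ n ih =>
    rw [daRejections_succ] at h ⊢
    have hq : E.quota s ≤ ((pool Q A B (daRejections E Q A B n) s).filter
        fun j => (E.priority s).strict j i).card := by
      rcases mem_daStep.1 h with h | h
      · exact ih h
      · exact h.2
    refine ((E.priority s).le_card_filter_top _ _ _ hq).trans
      (Finset.card_le_card fun j hj => ?_)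
    simp only [Finset.mem_filter] at hj ⊢
    refine ⟨?_, hj.2⟩
    have hj' := mem_pool.1 hj.1.1
    refine mem_pool.2 ⟨hj'.1, target_eq_of_subset (subset_daStep _ _ _ _ _ _) hj'.2 ?_⟩
    rw [mem_daStep]
    rintro (hs | hs)
    · exact (mem_of_target hj'.2).2 hs
    · exact absurd hj.1.2 (not_lt.2 hs.2)

open Classical in
theorem card_better_lt_of_mem_pool {i : I} {s : S}
    (h : i ∈ pool Q A B (finalRejections E Q A B) s) :
    ((pool Q A B (finalRejections E Q A B) s).filter
      fun j => (E.priority s).strict j i).card < E.quota s := by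
  by_contra! hle
  have := mem_daStep.2 (Or.inr ⟨h, hle⟩)
  rw [finalRejections, daStep_final] at this
  exact (mem_of_target (mem_pool.1 h).2).2 this

open Classical in
/-- Comparative statics: if every student of one market who finds some school in `B` acceptable
takes part in a second market with the same preference, then each rejection in the first market
also happens in the second one. -/
theorem daRejections_subset_finalRejections
    (h : ∀ i ∈ A, ∀ s ∈ B, (Q i).strict (some s) none → i ∈ A' ∧ Q' i = Q i) (n : ℕ) (i : I) :
    daRejections E Q A B n i ⊆ finalRejections E Q' A' B i := by
  induction n generalizing i with
  | zero => simp [daRejections]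
  | succ n ih =>
    intro s hs
    rw [daRejections_succ, mem_daStep] at hs
    rcases hs with hs | ⟨hi, hq⟩
    · exact ih i hs
    · have hpool : ∀ j, j ∈ pool Q A B (daRejections E Q A B n) s →
          s ∉ finalRejections E Q' A' B j → j ∈ pool Q' A' B (finalRejections E Q' A' B) s := by
        intro j hj hjs
        have hj' := mem_pool.1 hj
        have hA := h j hj'.1 s (mem_of_target hj'.2).1 (acceptable_of_target hj'.2)
        refine mem_pool.2 ⟨hA.1, ?_⟩
        rw [hA.2]
        exact target_eq_of_subset (ih j) hj'.2 hjs
      by_contra hcon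
      refine absurd (card_better_lt_of_mem_pool (hpool i hi hcon)) (not_lt.2 ?_)
      by_cases hex : ∃ j ∈ pool Q A B (daRejections E Q A B n) s,
          (E.priority s).strict j i ∧ s ∈ finalRejections E Q' A' B j
      · obtain ⟨j, -, hji, hjs⟩ := hex
        refine (quota_le_of_mem_daRejections _ hjs).trans (Finset.card_le_card fun l hl => ?_)
        simp only [Finset.mem_filter] at hl ⊢
        exact ⟨hl.1, (E.priority s).strict_trans hl.2 hji⟩
      · push Not at hex
        refine hq.trans (Finset.card_le_card fun j hj => ?_)
        simp only [Finset.mem_filter] at hj ⊢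
        exact ⟨hpool j hj.1 (hex j hj.1 hj.2), hj.2⟩

theorem deferredAcceptance_of_mem {i : I} (hi : i ∈ A) :
    deferredAcceptance E Q A B i = target (Q i) B (finalRejections E Q A B i) :=
  if_pos hi

theorem deferredAcceptance_of_notMem {i : I} (hi : i ∉ A) :
    deferredAcceptance E Q A B i = none :=
  if_neg hi

theorem deferredAcceptance_eq_some_iff {i : I} {s : S} :
    deferredAcceptance E Q A B i = some s ↔ i ∈ pool Q A B (finalRejections E Q A B) s := by
  rw [mem_pool]
  by_cases hi : i ∈ A
  · simp [deferredAcceptance_of_mem hi, hi]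
  · simp [deferredAcceptance_of_notMem hi, hi]

theorem mem_of_deferredAcceptance_eq_some {i : I} {s : S}
    (h : deferredAcceptance E Q A B i = some s) :
    i ∈ A ∧ s ∈ B ∧ (Q i).strict (some s) none := by
  have h' := mem_pool.1 (deferredAcceptance_eq_some_iff.1 h)
  exact ⟨h'.1, (mem_of_target h'.2).1, acceptable_of_target h'.2⟩

theorem deferredAcceptance_weak_deferredAcceptance
    (h : ∀ i ∈ A, ∀ s ∈ B, (Q i).strict (some s) none → i ∈ A' ∧ Q' i = Q i)
    {i : I} (hi : i ∈ A) (hi' : i ∈ A') (hQ : Q' i = Q i) :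
    (Q i).weak (deferredAcceptance E Q A B i) (deferredAcceptance E Q' A' B i) := by
  rw [deferredAcceptance_of_mem hi, deferredAcceptance_of_mem hi', hQ]
  rcases h' : target (Q i) B (finalRejections E Q' A' B i) with _ | s
  · exact target_weak_none
  · have := mem_of_target h'
    exact target_weak this.1 fun hs => this.2 (daRejections_subset_finalRejections h _ i hs)

/-- If the first choices within `B` respect the quotas, then all students get their first choices
within `B`. -/
theorem deferredAcceptance_eq_target_empty
    (h : ∀ s ∈ B, (pool Q A B (fun _ => ∅) s).card ≤ E.quota s) {i : I} (hi : i ∈ A) :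
    deferredAcceptance E Q A B i = target (Q i) B ∅ := by
  classical
  have hn : ∀ n, daRejections E Q A B n = fun _ => ∅ := by
    refine fun n => Function.iterate_fixed ?_ n
    funext j
    rw [Finset.eq_empty_iff_forall_notMem]
    intro s hs
    rcases mem_daStep.1 hs with hs | ⟨hj, hq⟩
    · simp at hs
    · refine absurd (hq.trans_lt (Finset.card_lt_card
        (Finset.filter_ssubset.2 ⟨j, hj, (E.priority s).strict_irrefl j⟩))) (not_lt.2 ?_)
      exact h s (mem_of_target (mem_pool.1 hj).2).1
  rw [deferredAcceptance_of_mem hi, finalRejections, hn]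

variable [Fintype I]

theorem mem_assigned {μ : I → Option S} {s : S} {i : I} : i ∈ assigned μ s ↔ μ i = some s := by
  simp [assigned]

open Classical in
/-- Under `μ`, the quota of the school `s` is exhausted by students with a higher priority
than `i`. -/
def Excludes (E : PriorityStructure I S) (μ : I → Option S) (s : S) (i : I) : Prop :=
  E.quota s ≤ ((assigned μ s).filter fun j => (E.priority s).strict j i).card

theorem Excludes.full {μ : I → Option S} {s : S} {i : I} (h : Excludes E μ s i)
    (hμ : IsMatching E μ) :
    (assigned μ s).card = E.quota s ∧ ∀ j, μ j = some s → (E.priority s).strict j i := by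
  classical
  have h1 := Finset.card_filter_le (assigned μ s) fun j => (E.priority s).strict j i
  have h2 := hμ s
  have h3 : (assigned μ s).card = E.quota s := le_antisymm h2 (le_trans h h1)
  refine ⟨h3, fun j hj => ?_⟩
  have h4 := Finset.eq_of_subset_of_card_le (Finset.filter_subset _ _) (h3.le.trans h)
  rw [← mem_assigned, ← h4] at hj
  exact (Finset.mem_filter.1 hj).2

theorem Excludes.of_full {μ : I → Option S} {s : S} {i : I}
    (hq : E.quota s ≤ (assigned μ s).card)
    (h : ∀ j, μ j = some s → (E.priority s).strict j i) : Excludes E μ s i := by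
  classical
  unfold Excludes
  rwa [Finset.filter_true_of_mem fun j hj => h j (mem_assigned.1 hj)]

theorem assigned_deferredAcceptance (s : S) :
    assigned (deferredAcceptance E Q A B) s = pool Q A B (finalRejections E Q A B) s := by
  ext i
  rw [mem_assigned, deferredAcceptance_eq_some_iff]

theorem isMatching_deferredAcceptance : IsMatching E (deferredAcceptance E Q A B) := by
  classical
  intro s
  rw [assigned_deferredAcceptance]
  rcases (pool Q A B (finalRejections E Q A B) s).eq_empty_or_nonempty with h | h
  · simp [h]
  · obtain ⟨w, hw, hworst⟩ := (E.priority s).exists_worst _ h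
    have hlt := card_better_lt_of_mem_pool hw
    have hle : (pool Q A B (finalRejections E Q A B) s).erase w ⊆
        (pool Q A B (finalRejections E Q A B) s).filter fun j => (E.priority s).strict j w := by
      intro j hj
      obtain ⟨hne, hj⟩ := Finset.mem_erase.1 hj
      exact Finset.mem_filter.2 ⟨hj, hworst j hj, hne⟩
    have := Finset.card_le_card hle
    rw [Finset.card_erase_of_mem hw] at this
    omega

theorem excludes_of_mem_finalRejections {i : I} {s : S} (h : s ∈ finalRejections E Q A B i) :
    Excludes E (deferredAcceptance E Q A B) s i := by
  classical
  unfold Excludes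
  rw [assigned_deferredAcceptance]
  exact quota_le_of_mem_daRejections _ h

/-- The outcome of deferred acceptance is stable within the market. -/
theorem excludes_of_strict {i : I} {s : S} (hi : i ∈ A) (hs : s ∈ B)
    (h : (Q i).strict (some s) (deferredAcceptance E Q A B i)) :
    Excludes E (deferredAcceptance E Q A B) s i := by
  refine excludes_of_mem_finalRejections ?_
  by_contra hcon
  rw [deferredAcceptance_of_mem hi] at h
  exact (Q i).not_strict_of_weak (target_weak hs hcon) h

theorem full_of_strict {i : I} {s : S} (hi : i ∈ A) (hs : s ∈ B)
    (h : (Q i).strict (some s) (deferredAcceptance E Q A B i)) :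
    (assigned (deferredAcceptance E Q A B) s).card = E.quota s ∧
      ∀ j, deferredAcceptance E Q A B j = some s → (E.priority s).strict j i :=
  (excludes_of_strict hi hs h).full isMatching_deferredAcceptance

/-- Schools become weakly more selective as the market grows. The student `i` need not take
part in either market. -/
theorem Excludes.mono
    (h : ∀ i ∈ A, ∀ s ∈ B, (Q i).strict (some s) none → i ∈ A' ∧ Q' i = Q i) {i : I} {s : S}
    (hex : Excludes E (deferredAcceptance E Q A B) s i) :
    Excludes E (deferredAcceptance E Q' A' B) s i := by
  classical
  by_cases hj : ∃ j, (E.priority s).strict j i ∧ s ∈ finalRejections E Q' A' B j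
  · obtain ⟨j, hji, hjs⟩ := hj
    have := (excludes_of_mem_finalRejections hjs).full isMatching_deferredAcceptance
    exact .of_full this.1.ge fun l hl => (E.priority s).strict_trans (this.2 l hl) hji
  · push Not at hj
    refine le_trans hex (Finset.card_le_card fun j hj' => ?_)
    simp only [Finset.mem_filter, mem_assigned] at hj' ⊢
    refine ⟨?_, hj'.2⟩
    have hm := mem_of_deferredAcceptance_eq_some hj'.1
    obtain ⟨hA, hQ⟩ := h j hm.1 s hm.2.1 hm.2.2
    rw [deferredAcceptance_of_mem hm.1] at hj'
    rw [deferredAcceptance_of_mem hA, hQ]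
    exact target_eq_of_subset (daRejections_subset_finalRejections h _ j) hj'.1 (hj j hj'.2)

end Market

/-! ### The tiered mechanism -/

section Tiered

theorem exists_tier_eq_succ {S : Type*} (t : TierStructure S) (s : S) : ∃ k, t.tier s = k + 1 := by
  have := (Finset.mem_Icc.1 (t.tier_mem s)).1
  exact ⟨t.tier s - 1, by omega⟩

variable {I S : Type*} [Fintype I] [Fintype S] {E : PriorityStructure I S} {t : TierStructure S}
  {Q Q' : I → Preference S}

open Classical in
/-- The students who are still unmatched after `k` rounds of the tiered mechanism. -/
noncomputable def unmatchedAfter (E : PriorityStructure I S) (t : TierStructure S)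
    (Q : I → Preference S) (k : ℕ) : Finset I :=
  Finset.univ.filter fun i => tdaAfter E t Q k i = none

/-- The outcome of round `k + 1` of the tiered mechanism. -/
noncomputable def roundOutcome (E : PriorityStructure I S) (t : TierStructure S)
    (Q : I → Preference S) (k : ℕ) : I → Option S :=
  deferredAcceptance E Q (unmatchedAfter E t Q k) (tierSchools t (k + 1))

theorem mem_tierSchools {k : ℕ} {s : S} : s ∈ tierSchools t k ↔ t.tier s = k := by
  simp [tierSchools]

theorem mem_unmatchedAfter {k : ℕ} {i : I} :
    i ∈ unmatchedAfter E t Q k ↔ tdaAfter E t Q k i = none := by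
  simp [unmatchedAfter]

theorem tdaAfter_succ (k : ℕ) (i : I) :
    tdaAfter E t Q (k + 1) i =
      if tdaAfter E t Q k i = none then roundOutcome E t Q k i else tdaAfter E t Q k i := by
  simp only [tdaAfter, roundOutcome, unmatchedAfter]

theorem mem_of_roundOutcome_eq_some {k : ℕ} {i : I} {s : S}
    (h : roundOutcome E t Q k i = some s) :
    i ∈ unmatchedAfter E t Q k ∧ t.tier s = k + 1 ∧ (Q i).strict (some s) none := by
  have := mem_of_deferredAcceptance_eq_some h
  exact ⟨this.1, mem_tierSchools.1 this.2.1, this.2.2⟩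

theorem roundOutcome_full_of_strict {k : ℕ} {i : I} {s : S} (hi : i ∈ unmatchedAfter E t Q k)
    (hs : t.tier s = k + 1) (h : (Q i).strict (some s) (roundOutcome E t Q k i)) :
    (assigned (roundOutcome E t Q k) s).card = E.quota s ∧
      ∀ j, roundOutcome E t Q k j = some s → (E.priority s).strict j i :=
  full_of_strict hi (mem_tierSchools.2 hs) h

theorem tdaAfter_eq_some_iff {n k : ℕ} {i : I} {s : S} (hs : t.tier s = k + 1) :
    tdaAfter E t Q n i = some s ↔ k + 1 ≤ n ∧ roundOutcome E t Q k i = some s := by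
  induction n with
  | zero => simp [tdaAfter]
  | succ n ih =>
    rw [tdaAfter_succ]
    rcases h : tdaAfter E t Q n i with _ | c
    · rw [if_pos rfl]
      constructor
      · intro h'
        have := (mem_of_roundOutcome_eq_some h').2.1
        obtain rfl : n = k := by omega
        exact ⟨le_rfl, h'⟩
      · rintro ⟨hk, h'⟩
        obtain rfl | hlt : n = k ∨ k + 1 ≤ n := by omega
        · exact h'
        · have := ih.2 ⟨hlt, h'⟩
          simp [h] at this
    · rw [if_neg (by simp), ← h, ih]
      constructor
      · exact fun h' => ⟨h'.1.trans n.le_succ, h'.2⟩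
      · rintro ⟨hk, h'⟩
        refine ⟨?_, h'⟩
        by_contra hcon
        obtain rfl : n = k := by omega
        have := mem_unmatchedAfter.1 (mem_of_roundOutcome_eq_some h').1
        simp [h] at this

theorem TDA_eq_some_iff {k : ℕ} {i : I} {s : S} (hs : t.tier s = k + 1) :
    TDA E t Q i = some s ↔ roundOutcome E t Q k i = some s := by
  rw [TDA, tdaAfter_eq_some_iff hs, and_iff_right]
  exact hs ▸ (Finset.mem_Icc.1 (t.tier_mem s)).2

theorem assigned_TDA {k : ℕ} {s : S} (hs : t.tier s = k + 1) :
    assigned (TDA E t Q) s = assigned (roundOutcome E t Q k) s := by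
  ext i
  rw [mem_assigned, mem_assigned, TDA_eq_some_iff hs]

theorem isMatching_TDA : IsMatching E (TDA E t Q) := by
  intro s
  obtain ⟨k, hk⟩ := exists_tier_eq_succ t s
  rw [assigned_TDA hk]
  exact isMatching_deferredAcceptance s

theorem tdaAfter_eq_some {n : ℕ} {i : I} {s : S} (h : tdaAfter E t Q n i = some s) :
    t.tier s ≤ n ∧ (Q i).strict (some s) none := by
  obtain ⟨k, hk⟩ := exists_tier_eq_succ t s
  rw [tdaAfter_eq_some_iff hk] at h
  exact ⟨hk ▸ h.1, (mem_of_roundOutcome_eq_some h.2).2.2⟩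

theorem acceptable_of_TDA {i : I} {s : S} (h : TDA E t Q i = some s) :
    (Q i).strict (some s) none :=
  (tdaAfter_eq_some h).2

/-- A student takes part in round `k + 1` if all acceptable schools are in tier `k + 1`. -/
theorem mem_unmatchedAfter_of_acceptable {k : ℕ} {i : I}
    (h : ∀ s, (Q i).strict (some s) none → t.tier s = k + 1) : i ∈ unmatchedAfter E t Q k := by
  rw [mem_unmatchedAfter]
  rcases h' : tdaAfter E t Q k i with _ | s
  · rfl
  · have := tdaAfter_eq_some h'
    have := h s this.2
    omega

/-- If the first choices `μ` form a matching and the students find only schools in the tier of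
their first choice acceptable, then the tiered mechanism yields `μ`. -/
theorem TDA_eq_of_top {μ : I → Option S} (hμ : IsMatching E μ)
    (htop : ∀ i z, (Q i).weak (μ i) z)
    (htier : ∀ i s s', (Q i).strict (some s) none → μ i = some s' → t.tier s = t.tier s') :
    TDA E t Q = μ := by
  have hacc : ∀ i s, μ i = some s → (Q i).strict (some s) none :=
    fun i s h => ⟨h ▸ htop i none, by simp⟩
  have htarget : ∀ (k : ℕ) i s,
      target (Q i) (tierSchools t (k + 1)) ∅ = some s ↔ μ i = some s ∧ t.tier s = k + 1 := by
    intro k i s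
    constructor
    · intro h
      have hs := mem_tierSchools.1 (mem_of_target h).1
      refine ⟨?_, hs⟩
      rcases h' : μ i with _ | c
      · exact absurd (acceptable_of_target h) ((Q i).not_strict_of_weak (h' ▸ htop i _))
      · have hc := htier i s c (acceptable_of_target h) h'
        refine (Q i).antisymm _ _ (h' ▸ htop i _) (h ▸ target_weak ?_ (by simp))
        exact mem_tierSchools.2 (hc ▸ hs)
    · rintro ⟨h, hs⟩
      refine (Q i).antisymm _ _ (target_weak (mem_tierSchools.2 hs) (by simp)) (h ▸ htop i _)
  have hround : ∀ i s, μ i = some s → TDA E t Q i = some s := by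
    intro i s h
    obtain ⟨k, hk⟩ := exists_tier_eq_succ t s
    rw [TDA_eq_some_iff hk, roundOutcome, deferredAcceptance_eq_target_empty, htarget]
    · exact ⟨h, hk⟩
    · intro c _
      refine le_trans (Finset.card_le_card fun j hj => ?_) (hμ c)
      exact mem_assigned.2 ((htarget k j c).1 (mem_pool.1 hj).2).1
    · exact mem_unmatchedAfter_of_acceptable fun c hc => (htier i c s hc h).trans hk
  funext i
  rcases h : μ i with _ | s
  · rcases h' : TDA E t Q i with _ | c
    · rfl
    · exact absurd (acceptable_of_TDA h') ((Q i).not_strict_of_weak (h ▸ htop i _))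
  · exact hround i s h

end Tiered

/-! ### Preferences with at most two acceptable schools -/

section ShortList

variable {S : Type*} [Fintype S]

open Classical in
/-- The rank of `z` in a preference that starts with `x`, then `y`, then being unmatched. -/
noncomputable def shortListRank (x y z : Option S) : ℕ :=
  if z = x then 0 else if z = y then 1 else if z = none then 2 else 3

/-- The preference that ranks `x` first, `y` second and being unmatched next, as far as these are
different; the other schools follow in an arbitrary order. -/
noncomputable def shortList (x y : Option S) : Preference S where
  weak z w := toLex (shortListRank x y z, Fintype.equivFin (Option S) z) ≤
    toLex (shortListRank x y w, Fintype.equivFin (Option S) w)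
  refl _ := le_rfl
  antisymm z w h h' := by
    have := le_antisymm h h'
    rw [toLex_inj, Prod.mk.injEq, EmbeddingLike.apply_eq_iff_eq] at this
    exact this.2
  trans _ _ _ := le_trans
  total _ _ := le_total _ _

theorem shortList_strict_of_rank_lt {x y z w : Option S}
    (h : shortListRank x y z < shortListRank x y w) : (shortList x y).strict z w := by
  refine ⟨Prod.Lex.toLex_le_toLex.2 (Or.inl h), ?_⟩
  rintro rfl
  exact lt_irrefl _ h

theorem shortList_strict_first {x y z : Option S} (h : z ≠ x) : (shortList x y).strict x z := by
  refine shortList_strict_of_rank_lt ?_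
  simp only [shortListRank, if_true, if_neg h]
  split_ifs <;> omega

theorem shortList_weak_first (x y z : Option S) : (shortList x y).weak x z := by
  by_cases h : z = x
  · exact h ▸ Ranking.refl _ _
  · exact (shortList_strict_first h).1

theorem shortList_strict_second {x y z : Option S} (hx : z ≠ x) (hy : z ≠ y) :
    (shortList x y).strict y z := by
  refine shortList_strict_of_rank_lt ?_
  simp only [shortListRank, if_neg hx, if_neg hy]
  split_ifs <;> omega

theorem shortList_weak_none {x y z : Option S} (hx : z ≠ x) (hy : z ≠ y) :
    (shortList x y).weak none z := by
  by_cases hz : z = none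
  · exact hz ▸ Ranking.refl _ _
  · refine (shortList_strict_of_rank_lt ?_).1
    simp only [shortListRank, if_neg hx, if_neg hy, if_neg hz]
    split_ifs <;> omega

theorem eq_of_shortList_acceptable {x y : Option S} {s : S}
    (h : (shortList x y).strict (some s) none) : some s = x ∨ some s = y := by
  by_contra! hcon
  exact Ranking.not_strict_of_weak _ (shortList_weak_none hcon.1 hcon.2) h

end ShortList

/-! ### Stable matchings are equilibrium outcomes -/

section Stable

variable {I S : Type*} [Fintype I] [Fintype S] {E : PriorityStructure I S} {t : TierStructure S}
  {R : I → Preference S}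

/-- A stable matching `μ` is the outcome of the equilibrium in which every student `i` reports
only `μ i` as acceptable. -/
theorem stableMatchings_subset_nashOutcomes :
    stableMatchings E R ⊆ nashOutcomes E t R := by
  classical
  rintro μ ⟨hμ, hIR, henvy, hwaste⟩
  have hTDA : TDA E t (fun i => shortList (μ i) (μ i)) = μ := by
    refine TDA_eq_of_top hμ (fun i z => shortList_weak_first _ _ _) fun i s s' h h' => ?_
    rcases eq_of_shortList_acceptable h with h | h <;>
    · rw [h', Option.some_inj] at h
      rw [h]
  refine ⟨_, fun i Q' => ?_, hTDA⟩
  rw [hTDA]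
  refine (R i).weak_of_not_strict fun hstr => ?_
  rcases hout : TDA E t (Function.update (fun i => shortList (μ i) (μ i)) i Q') i with _ | s
  · exact (R i).not_strict_of_weak (hIR i) (hout ▸ hstr)
  · rw [hout] at hstr
    obtain ⟨k, hk⟩ := exists_tier_eq_succ t s
    rw [TDA_eq_some_iff hk] at hout
    set P := Function.update (fun i => shortList (μ i) (μ i)) i Q' with hP
    have hPj : ∀ j, j ≠ i → P j = shortList (μ j) (μ j) := fun j hj => by
      rw [hP, Function.update_of_ne hj]
    have hne : μ i ≠ some s := fun h => hstr.2 h.symm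
    -- The students matched with `s` under `μ` keep their seats, or else `i` has priority.
    have hkeep : ∀ j, μ j = some s → roundOutcome E t P k j = some s := by
      intro j hj
      have hji : j ≠ i := by
        rintro rfl
        exact hne hj
      by_contra hcon
      have hA : j ∈ unmatchedAfter E t P k := by
        refine mem_unmatchedAfter_of_acceptable fun c hc => ?_
        rw [hPj j hji, hj] at hc
        rcases eq_of_shortList_acceptable hc with h | h <;>
        · rw [Option.some_inj] at h
          rw [h, hk]
      have hfull := roundOutcome_full_of_strict hA hk (by
        rw [hPj j hji, hj]
        exact shortList_strict_first hcon)
      exact henvy ⟨i, j, s, hj, hstr, hfull.2 i hout⟩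
    refine hwaste ⟨i, s, hstr, ?_⟩
    refine lt_of_lt_of_le (Finset.card_lt_card ?_)
      (isMatching_deferredAcceptance (E := E) (Q := P) (A := unmatchedAfter E t P k)
        (B := tierSchools t (k + 1)) s)
    refine Finset.ssubset_iff_subset_ne.2
      ⟨fun j hj => mem_assigned.2 (hkeep j (mem_assigned.1 hj)), fun heq => hne ?_⟩
    rw [← mem_assigned, heq]
    exact mem_assigned.2 hout

end Stable

/-! ### Cycles from improvements on a stable outcome -/

section Cycle

variable {I S : Type*} {E : PriorityStructure I S}

theorem isCycle_restrict {p : S → Prop} {a b : S} (ha : p a) (hb : p b) {i j k : I} :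
    IsCycle (E.restrict p) ⟨a, ha⟩ ⟨b, hb⟩ i j k ↔ IsCycle E a b i j k := by
  simp [IsCycle, PriorityStructure.restrict]

variable [Fintype I]

/-- Some student at the school `a` is turned away by the school `b`, which is full under `ν` and
has assigned all its seats to students with a higher priority. -/
def Blocks (E : PriorityStructure I S) (ν : I → Option S) (a b : S) : Prop :=
  ∃ x, ν x = some a ∧ (assigned ν b).card = E.quota b ∧
    ∀ y, ν y = some b → (E.priority b).strict y x

/-- A walk of length `n` along `Blocks` leads from the school `c` to the school `d`. -/
def BlockWalk (E : PriorityStructure I S) (ν : I → Option S) (d : S) : (n : ℕ) → (c : S) → Prop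
  | 0, c => c = d
  | n + 1, c => ∃ c', Blocks E ν c c' ∧ BlockWalk E ν d n c'

theorem exists_blockWalk {ν : I → Option S} {c d : S}
    (h : ReflTransGen (Blocks E ν) c d) : ∃ n, BlockWalk E ν d n c := by
  induction h using ReflTransGen.head_induction_on with
  | refl => exact ⟨0, rfl⟩
  | head h _ ih =>
    obtain ⟨n, hn⟩ := ih
    exact ⟨n + 1, _, h, hn⟩

theorem BlockWalk.exists_student {ν : I → Option S} {d : S} {z : I} (hz : ν z = some d) {n : ℕ}
    {c : S} (h : BlockWalk E ν d n c) : ∃ x, ν x = some c := by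
  cases n with
  | zero => exact ⟨z, h.symm ▸ hz⟩
  | succ n =>
    obtain ⟨_, ⟨x, hx, -⟩, -⟩ := h
    exact ⟨x, hx⟩

/-- The reduction of a long cycle to one with two schools. The school `c` is full of students with
a higher priority than `m`, who has a higher priority than `z`, and a shortest walk leads from `c`
to the school `d` of `z`. If the next school `c'` of the walk prefers `z` to the student `x` at `c`
whom it turns away, then `c`, `c'` and `x`, `m`, `z` form a cycle; otherwise `c'` and `x` can take
the places of `c` and `m`, and the walk is shorter. -/
theorem exists_isCycle_of_blockWalk {ν : I → Option S} {z : I} {d : S} (hz : ν z = some d)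
    (n : ℕ) (c : S) (m : I) (hcard : (assigned ν c).card = E.quota c)
    (hm : ∀ y, ν y = some c → (E.priority c).strict y m) (hmz : (E.priority c).strict m z)
    (hwalk : BlockWalk E ν d n c) (hmin : ∀ l < n, ¬ BlockWalk E ν d l c)
    (hmin' : ∀ l < n, ∀ c', ν m = some c' → ¬ BlockWalk E ν d l c') :
    ∃ a b i j k, IsCycle E a b i j k ∧ (∃ x, ν x = some a) ∧ ∃ x, ν x = some b := by
  classical
  induction n generalizing c m with
  | zero =>
    obtain rfl : c = d := hwalk
    exact absurd (hm z hz) ((E.priority c).strict_asymm hmz)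
  | succ n ih =>
    obtain ⟨c', ⟨x, hx, hcard', hx'⟩, hwalk'⟩ := hwalk
    have hxm := hm x hx
    have hxz := (E.priority c).strict_trans hxm hmz
    obtain ⟨w, hw⟩ := hwalk'.exists_student hz
    by_cases hzx : (E.priority c').strict z x
    · have hcc' : c ≠ c' := by
        rintro rfl
        exact (E.priority c).strict_irrefl x (hx' x hx)
      have hzc : ν z ≠ some c := fun h => (E.priority c).strict_asymm hmz (hm z h)
      have hmc : ν m ≠ some c := fun h => (E.priority c).strict_irrefl m (hm m h)
      have hmc' : ν m ≠ some c' := fun h => hmin' n n.lt_succ_self c' h hwalk'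
      have hpos : 0 < (assigned ν c').card := Finset.card_pos.2 ⟨w, mem_assigned.2 hw⟩
      have hpos' : 0 < (assigned ν c).card := Finset.card_pos.2 ⟨x, mem_assigned.2 hx⟩
      -- The student `z` may or may not be at `c'`.
      obtain ⟨Ib, hIb, hIbc⟩ := Finset.exists_subset_card_eq
        (Finset.pred_card_le_card_erase (s := assigned ν c') (a := z))
      have hIb' : ∀ l ∈ Ib, ν l = some c' := fun l hl =>
        mem_assigned.1 (Finset.mem_of_mem_erase (hIb hl))
      refine ⟨c, c', x, m, z, ⟨hcc', hxm.2, hmz.2, hxz.2, hxm, hmz, hzx,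
        (assigned ν c).erase x, Ib, ?_, ?_, ?_, ?_, ?_, ?_, ?_⟩, ⟨x, hx⟩, ⟨w, hw⟩⟩
      · rw [Finset.disjoint_left]
        intro l hl hl'
        have h1 := mem_assigned.1 (Finset.mem_of_mem_erase hl)
        rw [hIb' l hl', Option.some_inj] at h1
        exact hcc' h1.symm
      · intro l hl
        have h1 := mem_assigned.1 (Finset.mem_of_mem_erase hl)
        refine ⟨Finset.ne_of_mem_erase hl, ?_, ?_⟩
        · rintro rfl
          exact hmc h1
        · rintro rfl
          exact hzc h1
      · intro l hl
        have h1 := hIb' l hl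
        refine ⟨?_, ?_, Finset.ne_of_mem_erase (hIb hl)⟩
        · rintro rfl
          rw [hx, Option.some_inj] at h1
          exact hcc' h1
        · rintro rfl
          exact hmc' h1
      · exact fun l hl => hm l (mem_assigned.1 (Finset.mem_of_mem_erase hl))
      · exact fun l hl => hx' l (hIb' l hl)
      · rw [Finset.card_erase_of_mem (mem_assigned.2 hx)]
        omega
      · omega
    · refine ih c' x hcard' hx' ((E.priority c').strict_of_not_strict hzx hxz.2.symm) hwalk' ?_ ?_
      · exact fun l hl h => hmin (l + 1) (by omega) ⟨c', ⟨x, hx, hcard', hx'⟩, h⟩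
      · intro l hl c'' hc''
        rw [hx, Option.some_inj] at hc''
        exact hc'' ▸ hmin l (by omega)

/-- If every student at a school of `U` under `ν` is at a school of `U` under `μ` as well, and `μ`
fills no school of `U` better than `ν` does, then both fill the schools of `U` equally and with the
same students. -/
theorem exchange {μ ν : I → Option S} (U : Finset S)
    (hcard : ∀ c ∈ U, (assigned μ c).card ≤ (assigned ν c).card)
    (hsub : ∀ x, ∀ c ∈ U, ν x = some c → ∃ c' ∈ U, μ x = some c') :
    (∀ c ∈ U, (assigned μ c).card = (assigned ν c).card) ∧
      ∀ x, ∀ c ∈ U, μ x = some c → ∃ c' ∈ U, ν x = some c' := by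
  classical
  have hunion : ∀ κ : I → Option S,
      (U.biUnion (assigned κ)).card = ∑ c ∈ U, (assigned κ c).card := by
    refine fun κ => Finset.card_biUnion fun a _ b _ hab => Finset.disjoint_left.2 ?_
    intro x hx hx'
    rw [mem_assigned] at hx hx'
    exact hab (Option.some_inj.1 (hx.symm.trans hx'))
  have hss : U.biUnion (assigned ν) ⊆ U.biUnion (assigned μ) := by
    intro x hx
    simp only [Finset.mem_biUnion, mem_assigned] at hx ⊢
    obtain ⟨c, hc, hx⟩ := hx
    exact hsub x c hc hx
  have hle := Finset.sum_le_sum hcard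
  have hge := Finset.card_le_card hss
  rw [hunion, hunion] at hge
  refine ⟨(Finset.sum_eq_sum_iff_of_le hcard).1 (le_antisymm hle hge), fun x c hc hx => ?_⟩
  have heq := Finset.eq_of_subset_of_card_le hss (by rw [hunion, hunion]; exact hle)
  have hmem : x ∈ U.biUnion (assigned ν) := by
    rw [heq]
    exact Finset.mem_biUnion.2 ⟨c, hc, mem_assigned.2 hx⟩
  simpa only [Finset.mem_biUnion, mem_assigned] using hmem

/-- Suppose that the students who are at different schools under `μ` and `ν` are turned away at
their schools under `μ` when `ν` prevails. If an unmatched student `m` is turned away by `s` under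
`ν`, but not under `μ`, then there is a cycle. -/
theorem exists_isCycle [Fintype S] {μ ν : I → Option S} (hμ : IsMatching E μ)
    (hfull : ∀ x c, μ x = some c → ν x ≠ some c → (assigned ν c).card = E.quota c ∧
      ∀ y, ν y = some c → (E.priority c).strict y x)
    (hmatched : ∀ x c, ν x = some c → μ x ≠ none)
    {m : I} {s : S} (hνm : ν m = none) (hμm : μ m = none)
    (hcard : (assigned ν s).card = E.quota s)
    (hsm : ∀ y, ν y = some s → (E.priority s).strict y m) (hex : ¬ Excludes E μ s m) :
    ∃ a b i j k, IsCycle E a b i j k ∧ (∃ x, ν x = some a) ∧ ∃ x, ν x = some b := by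
  classical
  -- The students at the schools that can be reached from `s` stay within these schools.
  obtain ⟨hcards, hback⟩ := exchange (μ := μ) (ν := ν)
    (Finset.univ.filter fun c => ReflTransGen (Blocks E ν) s c)
    (by
      intro c _
      by_cases h : ∀ x, μ x = some c → ν x = some c
      · exact Finset.card_le_card fun x hx => mem_assigned.2 (h x (mem_assigned.1 hx))
      · push Not at h
        obtain ⟨x, hx, hx'⟩ := h
        exact (hμ c).trans (hfull x c hx hx').1.ge)
    (by
      intro x c hc hx
      obtain ⟨c', hc'⟩ := Option.ne_none_iff_exists'.1 (hmatched x c hx)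
      refine ⟨c', ?_, hc'⟩
      rw [Finset.mem_filter] at hc ⊢
      by_cases h : ν x = some c'
      · rw [hx, Option.some_inj] at h
        exact h ▸ hc
      · exact ⟨Finset.mem_univ _, hc.2.tail ⟨x, hx, hfull x c' hc' h⟩⟩)
  have hs : s ∈ Finset.univ.filter fun c => ReflTransGen (Blocks E ν) s c := by
    simp [ReflTransGen.refl]
  obtain ⟨z, hz, hzm⟩ : ∃ z, μ z = some s ∧ ¬ (E.priority s).strict z m := by
    by_contra! hcon
    exact hex (.of_full ((hcards s hs).trans hcard).ge hcon)
  have hzne : z ≠ m := by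
    rintro rfl
    simp [hμm] at hz
  obtain ⟨d, hd, hzd⟩ := hback z s hs hz
  have hwalk := exists_blockWalk (Finset.mem_filter.1 hd).2
  refine exists_isCycle_of_blockWalk hzd (Nat.find hwalk) s m hcard hsm
    ((E.priority s).strict_of_not_strict hzm hzne) (Nat.find_spec hwalk)
    (fun l hl => Nat.find_min hwalk hl) ?_
  simp [hνm]

end Cycle

/-! ### Equilibrium outcomes are stable under acyclicity -/

section Equilibrium

variable {I S : Type*} [Fintype I] [Fintype S] {E : PriorityStructure I S} {t : TierStructure S}
  {R Q : I → Preference S}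

theorem IsNashEquilibrium.individuallyRational (hQ : IsNashEquilibrium E t R Q) :
    IndividuallyRational R (TDA E t Q) := by
  classical
  intro i
  have h := hQ i (shortList none none)
  rcases h' : TDA E t (Function.update Q i (shortList none none)) i with _ | s
  · exact h' ▸ h
  · have hs := acceptable_of_TDA h'
    rw [Function.update_self] at hs
    rcases eq_of_shortList_acceptable hs with hs | hs <;> simp at hs

/-- If no other student reports differently and `i` reports only schools in tiers after `k` as
acceptable, then at most the same other students are left unmatched after `k` rounds. -/
theorem unmatchedAfter_mono {P : I → Preference S} {i : I} (hPQ : ∀ j, j ≠ i → P j = Q j) {k : ℕ}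
    (hi : ∀ s, (P i).strict (some s) none → k < t.tier s) {j : I} (hj : j ≠ i)
    (hjm : j ∈ unmatchedAfter E t P k) : j ∈ unmatchedAfter E t Q k := by
  induction k generalizing j with
  | zero => simp [unmatchedAfter, tdaAfter]
  | succ k ih =>
    have ih' := fun {j} => ih (fun s hs => k.lt_succ_self.trans (hi s hs)) (j := j)
    rw [mem_unmatchedAfter, tdaAfter_succ] at hjm ⊢
    split_ifs at hjm with hj0
    · have hjQ := ih' hj (mem_unmatchedAfter.2 hj0)
      rw [if_pos (mem_unmatchedAfter.1 hjQ)]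
      have hw : (P j).weak (roundOutcome E t P k j) (roundOutcome E t Q k j) := by
        refine deferredAcceptance_weak_deferredAcceptance (fun l hl c hc hacc => ?_)
          (mem_unmatchedAfter.2 hj0) hjQ (hPQ j hj).symm
        by_cases hli : l = i
        · have := hi c (hli ▸ hacc)
          rw [mem_tierSchools.1 hc] at this
          exact absurd this (lt_irrefl _)
        · exact ⟨ih' hli hl, (hPQ l hli).symm⟩
      rw [hjm] at hw
      rcases h : roundOutcome E t Q k j with _ | c
      · rfl
      · rw [h] at hw
        have := (mem_of_roundOutcome_eq_some h).2.2
        rw [← hPQ j hj] at this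
        exact absurd this ((P j).not_strict_of_weak hw)
    · exact absurd hjm hj0

/-- Under acyclicity, a student obtains any school that does not exclude him in the outcome of the
tiered mechanism by reporting only this school as acceptable. -/
theorem TDA_update_eq_some (hacyc : WithinTierAcyclic E t) {i : I} {s : S}
    (hex : ¬ Excludes E (TDA E t Q) s i) {P : I → Preference S} (hPQ : ∀ j, j ≠ i → P j = Q j)
    (hPi : P i = shortList (some s) (some s)) : TDA E t P i = some s := by
  classical
  obtain ⟨k, hk⟩ := exists_tier_eq_succ t s
  have hacc : ∀ c, (P i).strict (some c) none → c = s := by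
    intro c hc
    rw [hPi] at hc
    rcases eq_of_shortList_acceptable hc with h | h <;> exact Option.some_inj.1 h
  rw [TDA_eq_some_iff hk]
  by_contra hcon
  have hiA : i ∈ unmatchedAfter E t P k :=
    mem_unmatchedAfter_of_acceptable fun c hc => (hacc c hc) ▸ hk
  have hνi : roundOutcome E t P k i = none := by
    rcases h : roundOutcome E t P k i with _ | c
    · rfl
    · exact absurd (h.trans (congrArg some (hacc c (mem_of_roundOutcome_eq_some h).2.2))) hcon
  have hfulls := roundOutcome_full_of_strict hiA hk (by
    rw [hPi]
    exact shortList_strict_first hcon)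
  -- Compare with the market of round `k + 1` from which `i` is removed.
  set A := (unmatchedAfter E t P k).erase i with hA
  have hAi : i ∉ A := Finset.notMem_erase _ _
  have hmemA : ∀ j, j ∈ A ↔ j ≠ i ∧ j ∈ unmatchedAfter E t P k := fun j => Finset.mem_erase
  have hAP : ∀ j ∈ A, ∀ c ∈ tierSchools t (k + 1), (Q j).strict (some c) none →
      j ∈ unmatchedAfter E t P k ∧ P j = Q j :=
    fun j hj _ _ _ => ⟨((hmemA j).1 hj).2, hPQ j ((hmemA j).1 hj).1⟩
  have hAQ : ∀ j ∈ A, ∀ c ∈ tierSchools t (k + 1), (Q j).strict (some c) none →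
      j ∈ unmatchedAfter E t Q k ∧ Q j = Q j := by
    refine fun j hj _ _ _ => ⟨unmatchedAfter_mono hPQ (fun c hc => ?_) ((hmemA j).1 hj).1
      ((hmemA j).1 hj).2, rfl⟩
    rw [hacc c hc, hk]
    exact k.lt_succ_self
  have hweak : ∀ j ∈ A, (Q j).weak (deferredAcceptance E Q A (tierSchools t (k + 1)) j)
      (roundOutcome E t P k j) := fun j hj =>
    deferredAcceptance_weak_deferredAcceptance hAP hj ((hmemA j).1 hj).2
      (hPQ j ((hmemA j).1 hj).1)
  obtain ⟨a, b, x, y, z, hcycle, ⟨u, hu⟩, ⟨v, hv⟩⟩ := exists_isCycle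
    (μ := deferredAcceptance E Q A (tierSchools t (k + 1))) (ν := roundOutcome E t P k)
    isMatching_deferredAcceptance
    (by
      intro j c hj hne
      have hjA := (mem_of_deferredAcceptance_eq_some hj)
      have hw := hweak j hjA.1
      rw [hj, ← hPQ j ((hmemA j).1 hjA.1).1] at hw
      exact roundOutcome_full_of_strict ((hmemA j).1 hjA.1).2 (mem_tierSchools.1 hjA.2.1)
        ⟨hw, hne.symm⟩)
    (by
      intro j c hj hnone
      have hjA := mem_of_roundOutcome_eq_some hj
      have hji : j ≠ i := by
        rintro rfl
        simp [hνi] at hj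
      have hw := hweak j ((hmemA j).2 ⟨hji, hjA.1⟩)
      rw [hj, hnone, ← hPQ j hji] at hw
      exact (P j).not_strict_of_weak hw hjA.2.2)
    hνi (deferredAcceptance_of_notMem hAi) hfulls.1 hfulls.2
    (by
      intro h
      have := h.mono hAQ
      refine hex ?_
      unfold Excludes at this ⊢
      rwa [assigned_TDA hk])
  exact hacyc (k + 1) (hk ▸ t.tier_mem s) ⟨_, _, x, y, z,
    (isCycle_restrict (p := fun s => t.tier s = k + 1) (mem_of_roundOutcome_eq_some hu).2.1
      (mem_of_roundOutcome_eq_some hv).2.1).2 hcycle⟩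

theorem nashOutcomes_subset_stableMatchings (hacyc : WithinTierAcyclic E t) :
    nashOutcomes E t R ⊆ stableMatchings E R := by
  classical
  rintro _ ⟨Q, hQ, rfl⟩
  have hex : ∀ i s, (R i).strict (some s) (TDA E t Q i) → Excludes E (TDA E t Q) s i := by
    intro i s hs
    by_contra hcon
    have := hQ i (shortList (some s) (some s))
    rw [TDA_update_eq_some hacyc hcon (fun j hj => Function.update_of_ne hj _ _)
      (Function.update_self _ _ _)] at this
    exact (R i).not_strict_of_weak this hs
  refine ⟨isMatching_TDA, hQ.individuallyRational, ?_, ?_⟩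
  · rintro ⟨i, j, s, hj, hs, hij⟩
    exact (E.priority s).strict_asymm hij (((hex i s hs).full isMatching_TDA).2 j hj)
  · rintro ⟨i, s, hs, hlt⟩
    exact hlt.ne ((hex i s hs).full isMatching_TDA).1

end Equilibrium

/-! ### An unstable equilibrium outcome from a cycle -/

section Unstable

variable {I S : Type*} [Fintype I] [Fintype S] {E : PriorityStructure I S} {t : TierStructure S}

open Classical in
/-- The true preferences of the game in which a cycle creates an unstable equilibrium: `i` prefers
`b` to `a`, `k` prefers `a` to `b`, only `a` is acceptable for `j` and the students in `Ia`, and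
only `b` for the students in `Ib`. -/
noncomputable def cyclePreference (a b : S) (i j k : I) (Ia Ib : Finset I) (x : I) :
    Preference S :=
  if x = i then shortList (some b) (some a) else
  if x = k then shortList (some a) (some b) else
  if x = j ∨ x ∈ Ia then shortList (some a) (some a) else
  if x ∈ Ib then shortList (some b) (some b) else shortList none none

open Classical in
/-- The outcome of the unstable equilibrium, in which `j` reports no school as acceptable and all
other students get their first choices. -/
noncomputable def cycleOutcome (a b : S) (i j k : I) (Ia Ib : Finset I) (x : I) : Option S :=
  if x = i then some b else if x = k then some a else if x = j then none else
  if x ∈ Ia then some a else if x ∈ Ib then some b else none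

/-- If the cycle lies within a tier, then `j` cannot obtain `a`: he would be admitted ahead of `k`,
who would turn to `b` and displace `i` there, who would turn to `a` and displace `j`. -/
theorem TDA_cyclePreference_ne {a b : S} {i j k : I} (hij : i ≠ j) (hjk : j ≠ k) (hik : i ≠ k)
    (haij : (E.priority a).strict i j) (hbki : (E.priority b).strict k i)
    {Ia Ib : Finset I} (hIa : ∀ l ∈ Ia, l ≠ i ∧ l ≠ j ∧ l ≠ k)
    (hIb : ∀ l ∈ Ib, l ≠ i ∧ l ≠ j ∧ l ≠ k) (hdisj : Disjoint Ia Ib)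
    (hIa' : ∀ l ∈ Ia, (E.priority a).strict l j) (hIb' : ∀ l ∈ Ib, (E.priority b).strict l i)
    (hca : (Ia.card : ℤ) = (E.quota a : ℤ) - 1) (hcb : (Ib.card : ℤ) = (E.quota b : ℤ) - 1)
    (htier : t.tier a = t.tier b) {P : I → Preference S}
    (hP : ∀ x, x ≠ j → P x = cyclePreference a b i j k Ia Ib x) : TDA E t P j ≠ some a := by
  classical
  obtain ⟨K, hK⟩ := exists_tier_eq_succ t a
  have hK' : t.tier b = K + 1 := htier ▸ hK
  intro hj
  rw [TDA_eq_some_iff hK] at hj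
  set ν := roundOutcome E t P K with hν
  have hPi : P i = shortList (some b) (some a) := by simp [hP i hij, cyclePreference]
  have hPk : P k = shortList (some a) (some b) := by
    simp [hP k hjk.symm, cyclePreference, hik.symm]
  have hPa : ∀ l ∈ Ia, P l = shortList (some a) (some a) := by
    intro l hl
    obtain ⟨h1, h2, h3⟩ := hIa l hl
    simp [hP l h2, cyclePreference, h1, h3, hl]
  have hPb : ∀ l ∈ Ib, P l = shortList (some b) (some b) := by
    intro l hl
    obtain ⟨h1, h2, h3⟩ := hIb l hl
    simp [hP l h2, cyclePreference, h1, h2, h3, hl, Finset.disjoint_right.1 hdisj hl]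
  have hmem : ∀ x (y z : Option S), P x = shortList y z → (y = some a ∨ y = some b) →
      (z = some a ∨ z = some b) → x ∈ unmatchedAfter E t P K := by
    intro x y z hx hy hz
    refine mem_unmatchedAfter_of_acceptable fun c hc => ?_
    rw [hx] at hc
    rcases eq_of_shortList_acceptable hc with rfl | rfl
    · rcases hy with hy | hy <;> rw [Option.some_inj.1 hy] <;> assumption
    · rcases hz with hz | hz <;> rw [Option.some_inj.1 hz] <;> assumption
  have hνa : ∀ l ∈ Ia, ν l = some a := by
    intro l hl
    by_contra hcon
    refine (E.priority a).strict_asymm (hIa' l hl) ((roundOutcome_full_of_strict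
      (hmem l _ _ (hPa l hl) (by simp) (by simp)) hK ?_).2 j hj)
    rw [hPa l hl]
    exact shortList_strict_first hcon
  have hassigned : assigned ν a = insert j Ia := by
    symm
    refine Finset.eq_of_subset_of_card_le ?_ ?_
    · intro l hl
      rcases Finset.mem_insert.1 hl with rfl | hl
      · exact mem_assigned.2 hj
      · exact mem_assigned.2 (hνa l hl)
    · rw [Finset.card_insert_of_notMem fun h => (hIa j h).2.1 rfl]
      have := isMatching_deferredAcceptance (E := E) (Q := P) (A := unmatchedAfter E t P K)
        (B := tierSchools t (K + 1)) a
      change (assigned ν a).card ≤ _ at this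
      omega
  have hνia : ν i ≠ some a := by
    rw [ne_eq, ← mem_assigned, hassigned, Finset.mem_insert]
    rintro (h | h)
    · exact hij h
    · exact (hIa i h).1 rfl
  have hνka : ν k ≠ some a := by
    rw [ne_eq, ← mem_assigned, hassigned, Finset.mem_insert]
    rintro (h | h)
    · exact hjk h.symm
    · exact (hIa k h).2.2 rfl
  have hνi : ν i = some b := by
    by_contra hcon
    refine (E.priority a).strict_asymm haij ((roundOutcome_full_of_strict
      (hmem i _ _ hPi (by simp) (by simp)) hK ?_).2 j hj)
    rw [hPi]
    exact shortList_strict_second hcon hνia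
  have hνk : ν k = some b := by
    by_contra hcon
    refine (E.priority b).strict_asymm hbki ((roundOutcome_full_of_strict
      (hmem k _ _ hPk (by simp) (by simp)) hK' ?_).2 i hνi)
    rw [hPk]
    exact shortList_strict_second hνka hcon
  have hνb : ∀ l ∈ Ib, ν l = some b := by
    intro l hl
    by_contra hcon
    refine (E.priority b).strict_asymm (hIb' l hl) ((roundOutcome_full_of_strict
      (hmem l _ _ (hPb l hl) (by simp) (by simp)) hK' ?_).2 i hνi)
    rw [hPb l hl]
    exact shortList_strict_first hcon
  -- One student too many is now assigned to `b`.
  have hsub : insert i (insert k Ib) ⊆ assigned ν b := by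
    intro l hl
    rw [mem_assigned]
    rcases Finset.mem_insert.1 hl with rfl | hl
    · exact hνi
    · rcases Finset.mem_insert.1 hl with rfl | hl
      · exact hνk
      · exact hνb l hl
  have hle := (Finset.card_le_card hsub).trans (isMatching_deferredAcceptance b)
  rw [Finset.card_insert_of_notMem, Finset.card_insert_of_notMem] at hle
  · omega
  · exact fun h => (hIb k h).2.2 rfl
  · rw [Finset.mem_insert]
    rintro (h | h)
    · exact hik h
    · exact (hIb i h).1 rfl

theorem exists_nashOutcome_not_stable {a b : S} {i j k : I} (hcycle : IsCycle E a b i j k)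
    (htier : t.tier a = t.tier b) :
    ∃ R : I → Preference S, ∃ μ ∈ nashOutcomes E t R, μ ∉ stableMatchings E R := by
  classical
  obtain ⟨hab, hij, hjk, hik, haij, hajk, hbki, Ia, Ib, hdisj, hIa, hIb, hIa', hIb', hca, hcb⟩ :=
    hcycle
  set R := cyclePreference a b i j k Ia Ib with hR
  set μ := cycleOutcome a b i j k Ia Ib with hμ
  have hRj : R j = shortList (some a) (some a) := by
    simp [hR, cyclePreference, hij.symm, hjk]
  have hμj : μ j = none := by simp [hμ, cycleOutcome, hij.symm, hjk]
  have hμk : μ k = some a := by simp [hμ, cycleOutcome, hik.symm]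
  have htopR : ∀ x, x ≠ j → ∀ z, (R x).weak (μ x) z := by
    intro x hx z
    simp only [hR, hμ, cyclePreference, cycleOutcome, hx, if_false, false_or]
    split_ifs <;> exact shortList_weak_first _ _ _
  have htierR : ∀ x s, (R x).strict (some s) none → t.tier s = t.tier a := by
    intro x s hs
    simp only [hR, cyclePreference] at hs
    split_ifs at hs <;> rcases eq_of_shortList_acceptable hs with h | h <;> simp at h <;>
      simp [h, htier]
  have hμmatch : IsMatching E μ := by
    intro s
    by_cases hsa : s = a
    · have hsub : assigned μ s ⊆ insert k Ia := by
        intro x hx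
        rw [mem_assigned] at hx
        simp only [hμ, cycleOutcome, hsa] at hx
        rw [Finset.mem_insert]
        split_ifs at hx with h1 h2 h3 h4 h5 <;> simp_all
      have := (Finset.card_le_card hsub).trans (Finset.card_insert_le _ _)
      rw [hsa] at this ⊢
      omega
    · by_cases hsb : s = b
      · have hsub : assigned μ s ⊆ insert i Ib := by
          intro x hx
          rw [mem_assigned] at hx
          simp only [hμ, cycleOutcome, hsb] at hx
          rw [Finset.mem_insert]
          split_ifs at hx with h1 h2 h3 h4 h5 <;> simp_all
        have := (Finset.card_le_card hsub).trans (Finset.card_insert_le _ _)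
        rw [hsb] at this ⊢
        omega
      · have : assigned μ s = ∅ := by
          rw [Finset.eq_empty_iff_forall_notMem]
          intro x hx
          rw [mem_assigned] at hx
          simp only [hμ, cycleOutcome] at hx
          split_ifs at hx <;> simp_all
        simp [this]
  have hout : TDA E t (Function.update R j (shortList none none)) = μ := by
    refine TDA_eq_of_top hμmatch (fun x z => ?_) fun x s s' hs hs' => ?_
    · by_cases hx : x = j
      · rw [hx, Function.update_self, hμj]
        exact shortList_weak_first _ _ _
      · rw [Function.update_of_ne hx]
        exact htopR x hx z
    · by_cases hx : x = j
      · rw [hx, hμj] at hs'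
        simp at hs'
      · rw [Function.update_of_ne hx] at hs
        refine (htierR x s hs).trans (htierR x s' ⟨hs' ▸ htopR x hx none, by simp⟩).symm
  refine ⟨R, μ, ⟨_, fun x P' => ?_, hout⟩, fun hstable => ?_⟩
  · rw [hout]
    by_cases hx : x = j
    · subst hx
      rw [Function.update_idem, hμj, hRj]
      have := TDA_cyclePreference_ne (t := t) hij hjk hik haij hbki hIa hIb hdisj hIa' hIb'
        hca hcb htier (P := Function.update R x P') fun y hy => Function.update_of_ne hy _ _
      exact shortList_weak_none this this
    · exact htopR x hx _
  · refine hstable.2.2.1 ⟨j, k, a, hμk, ?_, hajk⟩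
    rw [hμj, hRj]
    exact shortList_strict_first (by simp)

end Unstable

end SchoolChoice

theorem theorem2 {I S : Type*} [Fintype I] [Fintype S]
    (E : SchoolChoice.PriorityStructure I S) (t : SchoolChoice.TierStructure S) :
    SchoolChoice.WithinTierAcyclic E t ↔
      ∀ R : I → SchoolChoice.Preference S,
        SchoolChoice.stableMatchings E R = SchoolChoice.nashOutcomes E t R := by
  refine ⟨fun h R => SchoolChoice.stableMatchings_subset_nashOutcomes.antisymm
    (SchoolChoice.nashOutcomes_subset_stableMatchings h), fun h => ?_⟩
  rintro K - ⟨⟨a, ha⟩, ⟨b, hb⟩, i, j, k, hcycle⟩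
  obtain ⟨R, μ, hμ, hμ'⟩ := SchoolChoice.exists_nashOutcome_not_stable (t := t)
    ((SchoolChoice.isCycle_restrict (p := fun s => t.tier s = K) ha hb).1 hcycle) (ha.trans hb.symm)
  exact hμ' ((h R).symm ▸ hμ)
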